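/- Let $X_1,X_2,\dots$ be i.i.d. exponential random variables with density $\theta_1^{-1}e^{-x/\theta_1}$, $x>0$, and let $Y_1,Y_2,\dots$ be i.i.d. exponential random variables with density $\theta_2^{-1}e^{-y/\theta_2}$, $y>0$, where $\theta_1,\theta_2>0$ and the two sequences are independent of each other. The upper record values of the first sequence are $X_{U(n)}=X_{T_n}$, where $T_1=1$ and $T_n=\min\{j: X_j>X_{T_{n-1}}\}$ for $n\ge 2$; those of the second sequence, $Y_{U(n)}$, are defined likewise. For integers $n_1,n_2\ge 1$ put $$\hat\theta_1=\frac{X_{U(n_1)}}{n_1},\qquad \hat\theta_2=\frac{Y_{U(n_2)}}{n_2},\qquad \hat\theta_p=\frac{n_1\hat\theta_1+n_2\hat\theta_2}{n_1+n_2}.$$ For real critical values $0\le c_1\le c_2$ (in particular for the $\alpha/2$ and $1-\alpha/2$ quantiles of the $F$ distribution with $(2n_1,2n_2)$ degrees of freedom, $0<\alpha\le 1$), the preliminary test estimator of $\theta_1$ is $$\hat\theta_{pt}=\begin{cases}\hat\theta_p & \text{if } c_1<\hat\theta_1/\hat\theta_2<c_2,\\ \hat\theta_1 & \text{otherwise.}\end{cases}$$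 Let $\lambda=\dfrac{n_2}{n_1+n_2}$, $\delta=\dfrac{\theta_2}{\theta_1}$, $d_i=1-\dfrac{n_2}{n_2+c_i n_1\delta}$ for $i=1,2$, and let $$I_d(a,b)=\frac{1}{B(a,b)}\int_0^d x^{a-1}(1-x)^{b-1}\,dx,\qquad B(a,b)=\int_0^1 x^{a-1}(1-x)^{b-1}\,dx,$$ be the regularized incomplete beta function. Then $\hat\theta_{pt}$ is square integrable and (i) its bias is $$E(\hat\theta_{pt})-\theta_1=-\lambda\theta_1\,[I_{d_2}(n_1+1,n_2)-I_{d_1}(n_1+1,n_2)]+\lambda\theta_2\,[I_{d_2}(n_1,n_2+1)-I_{d_1}(n_1,n_2+1)];$$ (ii) its mean square error is $$\begin{aligned}E\big[(\hat\theta_{pt}-\theta_1)^2\big]={}&\frac{n_1+1}{n_1}\theta_1^2+(\lambda^2-2\lambda)\,\theta_1^2\,\frac{n_1+1}{n_1}\,[I_{d_2}(n_1+2,n_2)-I_{d_1}(n_1+2,n_2)]\\&+\lambda^2\theta_2^2\,\frac{n_2+1}{n_2}\,[I_{d_2}(n_1,n_2+2)-I_{d_1}(n_1,n_2+2)]\\&+2(\lambda-\lambda^2)\,\theta_1\theta_2\,[I_{d_2}(n_1+1,n_2+1)-I_{d_1}(n_1+1,n_2+1)]-2\theta_1^2\\&-2\lambda\theta_1\theta_2\,[I_{d_2}(n_1,n_2+1)-I_{d_1}(n_1,n_2+1)]\\&+2\lambda\theta_1^2\,[I_{d_2}(n_1+1,n_2)-I_{d_1}(n_1+1,n_2)]+\theta_1^2.\end{aligned}$$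 -/

import Mathlib

open MeasureTheory ProbabilityTheory

namespace RecordPT

noncomputable section

/-- Upper record times of a real sequence, both the sequence and the records being indexed from `0`:
the first observation is a record, and the next record time is the first index at which the
sequence exceeds the current record. (If there is no further record, `sInf ∅ = 0`.) -/
def recordTime (x : ℕ → ℝ) : ℕ → ℕ
  | 0 => 0
  | k + 1 => sInf {j | x (recordTime x k) < x j}

/-- The `n`-th upper record value `x_{U(n)}`, for `n = 1, 2, …`. -/
def upperRecord (x : ℕ → ℝ) (n : ℕ) : ℝ := x (recordTime x (n - 1))

/-- The estimator `x_{U(n)} / n` of the scale, based on the first `n` upper records of `x`. -/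
def scaleEst (n : ℕ) (x : ℕ → ℝ) : ℝ := upperRecord x n / n

/-- The pooled estimator. -/
def pooledEst (n₁ n₂ : ℕ) (x y : ℕ → ℝ) : ℝ :=
  (n₁ * scaleEst n₁ x + n₂ * scaleEst n₂ y) / (n₁ + n₂)

open Classical in
/-- The preliminary test estimator of the first scale with critical values `c₁`, `c₂`. -/
def prelimTestEst (n₁ n₂ : ℕ) (c₁ c₂ : ℝ) (x y : ℕ → ℝ) : ℝ :=
  if c₁ < scaleEst n₁ x / scaleEst n₂ y ∧ scaleEst n₁ x / scaleEst n₂ y < c₂ then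
    pooledEst n₁ n₂ x y
  else scaleEst n₁ x

/-- The (regularized) incomplete beta function
`I_d(a, b) = B(a, b)⁻¹ ∫₀ᵈ x ^ (a - 1) (1 - x) ^ (b - 1) dx`. -/
def incBeta (d a b : ℝ) : ℝ :=
  (∫ x in (0 : ℝ)..d, x ^ (a - 1) * (1 - x) ^ (b - 1)) / ProbabilityTheory.beta a b

/-- The bias of an estimator `T` of `θ`. -/
def bias {Ω : Type*} [MeasurableSpace Ω] (μ : Measure Ω) (T : Ω → ℝ) (θ : ℝ) : ℝ :=
  (∫ ω, T ω ∂μ) - θ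

/-- The mean square error of an estimator `T` of `θ`. -/
def mse {Ω : Type*} [MeasurableSpace Ω] (μ : Measure Ω) (T : Ω → ℝ) (θ : ℝ) : ℝ :=
  ∫ ω, (T ω - θ) ^ 2 ∂μ

end

end RecordPT

/-! ### Record times along a single path. -/

namespace RecordPT

open Finset
open scoped ENNReal

/-! Let `U`, `V` be the two record values. They are independent, and each is gamma distributed, with
shape `n₁` (resp. `n₂`) and rate `1 / θ₁` (resp. `1 / θ₂`). The reason is that records form a Markov
chain: from the value `t`, the next record has the law of an observation conditioned to exceed `t`.
For exponential observations this step raises the gamma shape by one (`lintegral_gammaMeasure_succ`,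
`map_upperRecord_infinitePi`).

The estimator equals `U / n₁ + λ 1_A (V / n₂ - U / n₁)`, where the acceptance event `A` depends on
`U / V` only. Bias and mean square error therefore reduce to the moments `E[U ^ a V ^ b 1_A]` with
`a + b ≤ 2` and to the plain moments of `U`. A power of `U` or `V` multiplying its gamma density
only shifts the shape, up to a constant (`hasMean_indicator_pow_mul_pow`), so each truncated moment
is a constant times the probability of `A` under shifted shapes. A ratio of independent gammas is
beta prime, so that probability is a difference of two values of `incBeta`
(`gammaMeasure_prod_le_mul`, `measureReal_acceptRegion`). -/

/-- The indicator that none of the `m` observations following index `i` exceeds `x i`. -/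
noncomputable def noExceed (x : ℕ → ℝ) (i m : ℕ) : ℝ≥0∞ :=
  ∏ l ∈ range m, if x (i + 1 + l) ≤ x i then 1 else 0

/-- The indicator that index `i` is the `k`-th upper record time (counted from `0`), expressed
through the observations up to index `i` only. -/
noncomputable def recordWeight (x : ℕ → ℝ) : ℕ → ℕ → ℝ≥0∞
  | 0, 0 => 1
  | 0, _ + 1 => 0
  | _ + 1, 0 => 0
  | k + 1, j + 1 => ∑ p ∈ antidiagonal j,
      recordWeight x k p.1 * noExceed x p.1 p.2 * (if x p.1 < x (j + 1) then 1 else 0)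

lemma le_recordTime (x : ℕ → ℝ) (k : ℕ) : ∀ l ≤ recordTime x k, x l ≤ x (recordTime x k) := by
  induction k with
  | zero => intro l hl; simp_all [recordTime]
  | succ k ih =>
    intro l hl
    rcases hl.eq_or_lt with rfl | hlt
    · rfl
    -- If no later record exists, the default time `0` leaves no `l` below it.
    have hne : {j | x (recordTime x k) < x j}.Nonempty := by
      by_contra h
      rw [Set.not_nonempty_iff_eq_empty] at h
      simp [recordTime, h] at hlt
    have h1 : x (recordTime x k) < x (recordTime x (k + 1)) := Nat.sInf_mem hne
    have h2 : l ∉ {j | x (recordTime x k) < x j} := Nat.notMem_of_lt_sInf hlt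
    simp only [Set.mem_ofPred_eq, not_lt] at h2
    linarith

lemma noExceed_le_one (x : ℕ → ℝ) (i m : ℕ) : noExceed x i m ≤ 1 := by
  refine Finset.prod_le_one' fun l _ => ?_
  split_ifs <;> simp

lemma le_of_noExceed_ne_zero {x : ℕ → ℝ} {i m : ℕ} (h : noExceed x i m ≠ 0) {l : ℕ} (hl : i < l)
    (hlm : l ≤ i + m) : x l ≤ x i := by
  obtain ⟨d, rfl⟩ := Nat.exists_eq_add_of_lt hl
  have := (Finset.prod_ne_zero_iff.1 h) d (mem_range.2 (by omega))
  rw [show i + d + 1 = i + 1 + d by ring]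
  by_contra hc
  simp [hc] at this

/-- Only this direction holds: when records run out, `recordTime` takes the default value `0` while
all weights vanish. -/
lemma recordTime_eq_of_recordWeight_ne_zero {x : ℕ → ℝ} {k i : ℕ} (h : recordWeight x k i ≠ 0) :
    recordTime x k = i := by
  induction k generalizing i with
  | zero => cases i <;> simp_all [recordWeight, recordTime]
  | succ k ih =>
    cases i with
    | zero => simp [recordWeight] at h
    | succ j =>
      obtain ⟨p, hp, hne⟩ := Finset.exists_ne_zero_of_sum_ne_zero h
      rw [HasAntidiagonal.mem_antidiagonal] at hp
      simp only [ne_eq, mul_eq_zero, not_or] at hne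
      obtain ⟨⟨h1, h2⟩, h3⟩ := hne
      have hk := ih h1
      have hlt : x p.1 < x (j + 1) := by by_contra hc; simp [hc] at h3
      rw [recordTime, hk]
      refine le_antisymm (Nat.sInf_le hlt) (le_csInf ⟨_, hlt⟩ fun l hl => ?_)
      by_contra! hc
      have : x l ≤ x p.1 := by
        rcases le_or_gt l p.1 with hle | hgt
        · rw [← hk]; exact le_recordTime x k l (hk ▸ hle)
        · exact le_of_noExceed_ne_zero h2 hgt (by omega)
      exact absurd hl (not_lt.2 this)

/-- The weight at `p.1` is nonzero only for `p.1 = recordTime x k`, so at most one term of the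
antidiagonal sum survives. -/
lemma recordWeight_le_one (x : ℕ → ℝ) (k i : ℕ) : recordWeight x k i ≤ 1 := by
  induction k generalizing i with
  | zero => cases i <;> simp [recordWeight]
  | succ k ih =>
    cases i with
    | zero => simp [recordWeight]
    | succ j =>
      rw [recordWeight]
      by_cases hT : recordTime x k ≤ j
      · rw [Finset.sum_eq_single (recordTime x k, j - recordTime x k)]
        · refine mul_le_one' (mul_le_one' (ih _) (noExceed_le_one _ _ _)) ?_
          split_ifs <;> simp
        · intro p hp hne
          have : recordWeight x k p.1 = 0 := by
            by_contra hc
            have := recordTime_eq_of_recordWeight_ne_zero hc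
            rw [HasAntidiagonal.mem_antidiagonal] at hp
            exact hne (Prod.ext this.symm (by simp; omega))
          simp [this]
        · intro h
          exact absurd (HasAntidiagonal.mem_antidiagonal.2 (by simp; omega)) h
      · rw [Finset.sum_eq_zero]
        · simp
        · intro p hp
          have : recordWeight x k p.1 = 0 := by
            by_contra hc
            have := recordTime_eq_of_recordWeight_ne_zero hc
            rw [HasAntidiagonal.mem_antidiagonal] at hp
            omega
          simp [this]

/-- The inequality is strict only on paths whose records run out. It is enough later, where both
sides integrate to probability measures. -/
lemma tsum_recordWeight_mul_le (x : ℕ → ℝ) (k : ℕ) (f : ℝ → ℝ≥0∞) :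
    ∑' i, recordWeight x k i * f (x i) ≤ f (x (recordTime x k)) := by
  rw [tsum_eq_single (recordTime x k)]
  · exact mul_le_of_le_one_left' (recordWeight_le_one _ _ _)
  · intro i hi
    have : recordWeight x k i = 0 := by
      by_contra hc
      exact hi (recordTime_eq_of_recordWeight_ne_zero hc).symm
    simp [this]

/-- The new record index is split as `i + m + 1`: the previous record index `i`, then `m` failures,
then the success. This opens the way to a geometric series in `m`. -/
lemma tsum_recordWeight_succ (x : ℕ → ℝ) (k : ℕ) (f : ℝ → ℝ≥0∞) :
    ∑' j, recordWeight x (k + 1) j * f (x j) =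
      ∑' i, ∑' m, recordWeight x k i * noExceed x i m *
        ((if x i < x (i + m + 1) then 1 else 0) * f (x (i + m + 1))) := by
  rw [tsum_eq_zero_add' ENNReal.summable, ← ENNReal.tsum_prod,
    ← Finset.HasAntidiagonal.sigmaAntidiagonalEquivProd.tsum_eq, ENNReal.tsum_sigma']
  simp only [recordWeight, zero_mul, zero_add, Finset.sum_mul]
  refine tsum_congr fun j => ?_
  rw [tsum_fintype, ← Finset.sum_coe_sort]
  refine Finset.sum_congr rfl fun p _ => ?_
  obtain ⟨p, hp⟩ := p
  rw [HasAntidiagonal.mem_antidiagonal] at hp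
  simp only [Finset.HasAntidiagonal.sigmaAntidiagonalEquivProd_apply, hp, mul_assoc]

/-! ### Measurability of weights, record times and record values. -/

section Measurability

variable {Ω : Type*} [MeasurableSpace Ω] {X : ℕ → Ω → ℝ}

lemma measurable_noExceed {i m : ℕ} (h : ∀ l ≤ i + m, Measurable (X l)) :
    Measurable fun ω => noExceed (fun j => X j ω) i m := by
  unfold noExceed
  refine Finset.measurable_fun_prod _ fun l hl => ?_
  rw [mem_range] at hl
  exact Measurable.ite (measurableSet_le (h _ (by omega)) (h _ (by omega))) measurable_const
    measurable_const

lemma measurable_recordWeight {k i : ℕ} (h : ∀ l ≤ i, Measurable (X l)) :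
    Measurable fun ω => recordWeight (fun j => X j ω) k i := by
  induction k generalizing i with
  | zero => cases i <;> simp [recordWeight]
  | succ k ih =>
    cases i with
    | zero => simp [recordWeight]
    | succ j =>
      simp only [recordWeight]
      refine Finset.measurable_fun_sum _ fun p hp => ?_
      rw [HasAntidiagonal.mem_antidiagonal] at hp
      refine ((ih fun l hl => h l (by omega)).mul
        (measurable_noExceed fun l hl => h l (by omega))).mul ?_
      exact Measurable.ite (measurableSet_lt (h _ (by omega)) (h _ (by omega))) measurable_const
        measurable_const

lemma measurable_recordTime (k : ℕ) : Measurable fun x : ℕ → ℝ => recordTime x k := by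
  induction k with
  | zero => simp [recordTime]
  | succ k ih =>
    have hm : Measurable fun x : ℕ → ℝ => x (recordTime x k) :=
      (measurable_from_prod_countable_right (f := fun p : ℕ × (ℕ → ℝ) => p.2 p.1)
        fun n => measurable_pi_apply n).comp (ih.prodMk measurable_id)
    have hp (l : ℕ) : MeasurableSet {x : ℕ → ℝ | x (recordTime x k) < x l} :=
      measurableSet_lt hm (measurable_pi_apply l)
    refine measurable_to_countable' fun j => ?_
    -- Either `j` is a genuine first exceedance, or `j = 0` is the default value because nothing
    -- exceeds the current record.
    have : (fun x : ℕ → ℝ => recordTime x (k + 1)) ⁻¹' {j} =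
        ({x | x (recordTime x k) < x j} ∩ ⋂ l, ⋂ (_ : l < j), {x | x (recordTime x k) < x l}ᶜ) ∪
        ({x | j = 0} ∩ ⋂ l, {x | x (recordTime x k) < x l}ᶜ) := by
      ext x
      simp only [Set.mem_preimage, Set.mem_singleton_iff, Set.mem_union, Set.mem_inter_iff,
        Set.mem_ofPred_eq, Set.mem_iInter, Set.mem_compl_iff, recordTime]
      constructor
      · intro h
        rcases Set.eq_empty_or_nonempty {j | x (recordTime x k) < x j} with he | hne
        · right
          refine ⟨by rw [← h, he, Nat.sInf_empty], fun l hl => ?_⟩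
          have : l ∈ {j | x (recordTime x k) < x j} := hl
          simp [he] at this
        · left
          rw [← h]
          exact ⟨Nat.sInf_mem hne, fun l hl => Nat.notMem_of_lt_sInf hl⟩
      · rintro (⟨h1, h2⟩ | ⟨h1, h2⟩)
        · refine le_antisymm (Nat.sInf_le h1) (le_csInf ⟨_, h1⟩ fun l hl => ?_)
          by_contra! hc
          exact h2 l hc hl
        · rw [h1, show {j | x (recordTime x k) < x j} = ∅ by ext l; simpa using h2 l,
            Nat.sInf_empty]
    rw [this]
    refine ((hp j).inter (.iInter fun l => .iInter fun _ => (hp l).compl)).union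
      (.inter (.const _) (.iInter fun l => (hp l).compl))

lemma measurable_upperRecord (n : ℕ) : Measurable fun x : ℕ → ℝ => upperRecord x n :=
  (measurable_from_prod_countable_right (f := fun p : ℕ × (ℕ → ℝ) => p.2 p.1)
    fun n => measurable_pi_apply n).comp ((measurable_recordTime (n - 1)).prodMk measurable_id)

end Measurability

/-! ### One step of the record chain for a general i.i.d. sequence. -/

section Independence

variable {Ω : Type*} [MeasurableSpace Ω] {μ : Measure Ω} [IsProbabilityMeasure μ]
  {X : ℕ → Ω → ℝ} {ν : Measure ℝ}

/-- Freezing: `X (n + 1)` is independent of the past up to `n`, so it can be integrated out with the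
past held fixed. -/
lemma lintegral_next_of_iIndepFun (hX : ∀ i, StronglyMeasurable (X i)) (hi : iIndepFun X μ)
    (hν : ∀ i, μ.map (X i) = ν) {β : Type*} [MeasurableSpace β] {n : ℕ} {U : Ω → β}
    (hU : Measurable[Filtration.natural X hX n] U) {g : β × ℝ → ℝ≥0∞} (hg : Measurable g) :
    ∫⁻ ω, g (U ω, X (n + 1) ω) ∂μ = ∫⁻ ω, ∫⁻ y, g (U ω, y) ∂ν ∂μ := by
  have hU' : Measurable U := hU.mono ((Filtration.natural X hX).le n) le_rfl
  have hprob : IsProbabilityMeasure ν :=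
    hν 0 ▸ Measure.isProbabilityMeasure_map (hX 0).measurable.aemeasurable
  have hind : IndepFun U (X (n + 1)) μ :=
    ((IndepFun_iff_Indep _ _ _).2 (indep_of_indep_of_le_left
      (hi.indep_comap_natural_of_lt hX (Nat.lt_succ_self n)).symm hU.comap_le))
  have hmap := hind.map_prod_eq_prod_map_map hU'.aemeasurable (hX (n + 1)).measurable.aemeasurable
  rw [← lintegral_map (f := g) hg (hU'.prodMk (hX (n + 1)).measurable), hmap, hν,
    lintegral_prod _ hg.aemeasurable, lintegral_map hg.lintegral_prod_right' hU']

lemma measurable_natural (hX : ∀ i, StronglyMeasurable (X i)) {l n : ℕ} (h : l ≤ n) :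
    Measurable[Filtration.natural X hX n] (X l) :=
  ((Filtration.stronglyAdapted_natural hX l).mono ((Filtration.natural X hX).mono h)).measurable

/-- The last failure is integrated out first, contributing `ν (Set.Iic (X i ω))`. This factor
depends on `X i` only, so it is absorbed into `ψ`; hence the induction generalizes `ψ`. -/
lemma lintegral_recordWeight_mul_noExceed (hX : ∀ i, StronglyMeasurable (X i)) (hi : iIndepFun X μ)
    (hν : ∀ i, μ.map (X i) = ν) (k i m : ℕ) {ψ : ℝ → ℝ≥0∞} (hψ : Measurable ψ) :
    ∫⁻ ω, recordWeight (fun j => X j ω) k i * noExceed (fun j => X j ω) i m * ψ (X i ω) ∂μ =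
      ∫⁻ ω, recordWeight (fun j => X j ω) k i * (ν (Set.Iic (X i ω)) ^ m * ψ (X i ω)) ∂μ := by
  induction m generalizing ψ with
  | zero => simp [noExceed]
  | succ m ih =>
    have hF : Measurable fun t => ν (Set.Iic t) :=
      Monotone.measurable fun s t h => measure_mono (Set.Iic_subset_Iic.2 h)
    have hU : Measurable[Filtration.natural X hX (i + m)] fun ω =>
        (recordWeight (fun j => X j ω) k i * noExceed (fun j => X j ω) i m * ψ (X i ω), X i ω) := by
      refine Measurable.prodMk (Measurable.mul (Measurable.mul ?_ ?_) (hψ.comp ?_)) ?_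
      · exact @measurable_recordWeight Ω (Filtration.natural X hX (i + m)) X k i
          fun l hl => measurable_natural hX (by omega)
      · exact @measurable_noExceed Ω (Filtration.natural X hX (i + m)) X i m
          fun l hl => measurable_natural hX (by omega)
      all_goals exact measurable_natural hX (by omega)
    have hg : Measurable fun p : (ℝ≥0∞ × ℝ) × ℝ => p.1.1 * if p.2 ≤ p.1.2 then 1 else 0 :=
      measurable_fst.fst.mul (Measurable.ite (measurableSet_le measurable_snd measurable_fst.snd)
        measurable_const measurable_const)
    have hstep := lintegral_next_of_iIndepFun hX hi hν hU hg
    have hind (t : ℝ) : ∫⁻ y, (if y ≤ t then 1 else 0) ∂ν = ν (Set.Iic t) := by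
      rw [← lintegral_indicator_one measurableSet_Iic]
      rfl
    have hme (t : ℝ) : Measurable fun y : ℝ => if y ≤ t then (1 : ℝ≥0∞) else 0 :=
      Measurable.ite measurableSet_Iic measurable_const measurable_const
    simp only [lintegral_const_mul _ (hme _), hind] at hstep
    calc _ = _ := by
            refine (lintegral_congr fun ω => ?_).trans hstep
            simp only [noExceed, prod_range_succ]
            rw [show i + 1 + m = i + m + 1 by ring]
            ring
      _ = ∫⁻ ω, recordWeight (fun j => X j ω) k i * noExceed (fun j => X j ω) i m *
            (fun t => ν (Set.Iic t) * ψ t) (X i ω) ∂μ := lintegral_congr fun ω => by ring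
      _ = _ := by
            rw [ih (ψ := fun t => ν (Set.Iic t) * ψ t) (hF.mul hψ)]
            exact lintegral_congr fun ω => by ring

/-- Summing over the number of failures gives `∑ F ^ m = (1 - F)⁻¹`, the inverse of the tail of `ν`:
the next record is drawn from `ν` conditioned on the half-line above the current one. -/
lemma lintegral_tsum_recordWeight_succ (hX : ∀ i, StronglyMeasurable (X i)) (hi : iIndepFun X μ)
    (hν : ∀ i, μ.map (X i) = ν) (k : ℕ) {f : ℝ → ℝ≥0∞} (hf : Measurable f) :
    ∫⁻ ω, ∑' j, recordWeight (fun j => X j ω) (k + 1) j * f (X j ω) ∂μ =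
      ∫⁻ ω, ∑' i, recordWeight (fun j => X j ω) k i *
        ((ν (Set.Ioi (X i ω)))⁻¹ * ∫⁻ y in Set.Ioi (X i ω), f y ∂ν) ∂μ := by
  have hprob : IsProbabilityMeasure ν :=
    hν 0 ▸ Measure.isProbabilityMeasure_map (hX 0).measurable.aemeasurable
  have hm (i : ℕ) := (hX i).measurable
  have hF : Measurable fun t => ν (Set.Iic t) :=
    Monotone.measurable fun s t h => measure_mono (Set.Iic_subset_Iic.2 h)
  have hG : Measurable fun t => ν (Set.Ioi t) :=
    Antitone.measurable fun s t h => measure_mono (Set.Ioi_subset_Ioi h)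
  have hq : Measurable fun t => ∫⁻ y in Set.Ioi t, f y ∂ν :=
    Antitone.measurable fun s t h => lintegral_mono_set (Set.Ioi_subset_Ioi h)
  have hw (i : ℕ) : Measurable fun ω => recordWeight (fun j => X j ω) k i :=
    measurable_recordWeight fun l _ => hm l
  have hn (i m : ℕ) : Measurable fun ω => noExceed (fun j => X j ω) i m :=
    measurable_noExceed fun l _ => hm l
  have hnext (i m : ℕ) : ∫⁻ ω, recordWeight (fun j => X j ω) k i * noExceed (fun j => X j ω) i m *
        ((if X i ω < X (i + m + 1) ω then 1 else 0) * f (X (i + m + 1) ω)) ∂μ =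
      ∫⁻ ω, recordWeight (fun j => X j ω) k i * noExceed (fun j => X j ω) i m *
        ∫⁻ y in Set.Ioi (X i ω), f y ∂ν ∂μ := by
    have hU : Measurable[Filtration.natural X hX (i + m)] fun ω =>
        (recordWeight (fun j => X j ω) k i * noExceed (fun j => X j ω) i m, X i ω) := by
      refine Measurable.prodMk (Measurable.mul ?_ ?_) ?_
      · exact @measurable_recordWeight Ω (Filtration.natural X hX (i + m)) X k i
          fun l hl => measurable_natural hX (by omega)
      · exact @measurable_noExceed Ω (Filtration.natural X hX (i + m)) X i m
          fun l hl => measurable_natural hX (by omega)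
      · exact measurable_natural hX (by omega)
    have hg : Measurable fun p : (ℝ≥0∞ × ℝ) × ℝ =>
        p.1.1 * ((if p.1.2 < p.2 then 1 else 0) * f p.2) :=
      measurable_fst.fst.mul ((Measurable.ite (measurableSet_lt measurable_fst.snd measurable_snd)
        measurable_const measurable_const).mul (hf.comp measurable_snd))
    have hstep := lintegral_next_of_iIndepFun hX hi hν hU hg
    have hme (t : ℝ) : Measurable fun y : ℝ => (if t < y then (1 : ℝ≥0∞) else 0) * f y :=
      (Measurable.ite measurableSet_Ioi measurable_const measurable_const).mul hf
    have hind (t : ℝ) : ∫⁻ y, (if t < y then 1 else 0) * f y ∂ν = ∫⁻ y in Set.Ioi t, f y ∂ν := by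
      rw [← lintegral_indicator measurableSet_Ioi]
      refine lintegral_congr fun y => ?_
      by_cases h : t < y <;> simp [h]
    simpa only [lintegral_const_mul _ (hme _), hind] using hstep
  simp_rw [tsum_recordWeight_succ]
  rw [lintegral_tsum, lintegral_tsum]
  · refine tsum_congr fun i => ?_
    rw [lintegral_tsum]
    · simp_rw [hnext, lintegral_recordWeight_mul_noExceed hX hi hν k i _ hq]
      rw [← lintegral_tsum]
      · refine lintegral_congr fun ω => ?_
        rw [ENNReal.tsum_mul_left, ENNReal.tsum_mul_right, ENNReal.tsum_geometric,
          ← Set.compl_Iic, prob_compl_eq_one_sub measurableSet_Iic]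
      · intro m
        exact ((hw i).mul (((hF.comp (hm i)).pow_const m).mul (hq.comp (hm i)))).aemeasurable
    · intro m
      exact (((hw i).mul (hn i m)).mul ((Measurable.ite (measurableSet_lt (hm _) (hm _))
        measurable_const measurable_const).mul (hf.comp (hm _)))).aemeasurable
  · intro i
    exact ((hw i).mul ((hG.comp (hm i)).inv.mul (hq.comp (hm i)))).aemeasurable
  · intro i
    refine (Measurable.tsum fun m => ?_).aemeasurable
    exact (((hw i).mul (hn i m)).mul ((Measurable.ite (measurableSet_lt (hm _) (hm _))
        measurable_const measurable_const).mul (hf.comp (hm _))))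

end Independence

end RecordPT

/-! ### Gamma integrals. -/

namespace RecordPT

open scoped ENNReal

lemma measurable_gammaPDF (a r : ℝ) : Measurable (gammaPDF a r) :=
  (measurable_gammaPDFReal a r).ennreal_ofReal

lemma lintegral_gammaMeasure (a r : ℝ) (f : ℝ → ℝ≥0∞) :
    ∫⁻ x, f x ∂gammaMeasure a r = ∫⁻ x, gammaPDF a r x * f x :=
  lintegral_withDensity_eq_lintegral_mul_non_measurable _ (measurable_gammaPDF a r)
    (ae_of_all _ fun _ => ENNReal.ofReal_lt_top) f

lemma lintegral_congr_of_ne_zero {f g : ℝ → ℝ≥0∞} (hneg : ∀ x < 0, f x = g x)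
    (hpos : ∀ x, 0 < x → f x = g x) : ∫⁻ x, f x = ∫⁻ x, g x := by
  refine lintegral_congr_ae ?_
  filter_upwards [compl_mem_ae_iff.2 (measure_singleton (0 : ℝ))] with x hx
  rcases lt_or_gt_of_ne (show x ≠ 0 from hx) with h | h
  exacts [hneg x h, hpos x h]

lemma expMeasure_Ioi {r : ℝ} (hr : 0 < r) {t : ℝ} (ht : 0 ≤ t) :
    expMeasure r (Set.Ioi t) = ENNReal.ofReal (Real.exp (-(r * t))) := by
  have := isProbabilityMeasure_expMeasure hr
  rw [← Set.compl_Iic, prob_compl_eq_one_sub measurableSet_Iic, expMeasure, gammaMeasure,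
    withDensity_apply _ measurableSet_Iic]
  have h := lintegral_exponentialPDF_eq_antiDeriv hr t
  rw [if_pos ht] at h
  change 1 - ∫⁻ y in Set.Iic t, exponentialPDF r y = _
  rw [h, ← ENNReal.ofReal_one, ← ENNReal.ofReal_sub]
  · simp
  · rw [sub_nonneg, Real.exp_le_one_iff]
    nlinarith

lemma setLIntegral_rpow {a : ℝ} (ha : 0 < a) {c y : ℝ} (hc : 0 ≤ c) (hy : 0 ≤ y) :
    ∫⁻ t in Set.Ioc 0 y, ENNReal.ofReal (c * t ^ (a - 1)) = ENNReal.ofReal (c * (y ^ a / a)) := by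
  have hint : IntervalIntegrable (fun t : ℝ => t ^ (a - 1)) volume 0 y :=
    intervalIntegral.intervalIntegrable_rpow' (by linarith)
  rw [← ofReal_integral_eq_lintegral_ofReal ((intervalIntegrable_iff_integrableOn_Ioc_of_le hy).1
    (hint.const_mul c)), ← intervalIntegral.integral_of_le hy, intervalIntegral.integral_const_mul,
    integral_rpow (Or.inl (by linarith))]
  · simp [Real.zero_rpow ha.ne']
  · refine (ae_restrict_iff' measurableSet_Ioc).2 (ae_of_all _ fun t ht => ?_)
    have := ht.1
    positivity

/-- The transition of the record chain of an exponential sequence turns the gamma law of shape `a`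
into that of shape `a + 1`. -/
lemma lintegral_gammaMeasure_succ {a r : ℝ} (ha : 0 < a) (hr : 0 < r) {f : ℝ → ℝ≥0∞}
    (hf : Measurable f) :
    ∫⁻ t, (expMeasure r (Set.Ioi t))⁻¹ * (∫⁻ y in Set.Ioi t, f y ∂expMeasure r)
        ∂gammaMeasure a r =
      ∫⁻ y, f y ∂gammaMeasure (a + 1) r := by
  have hG : 0 < Real.Gamma a := Real.Gamma_pos_of_pos ha
  -- The gamma density divided by the exponential tail: the factors `exp (-(r * t))` cancel and a
  -- pure power remains. After Tonelli, integrating it over `(0, y)` gives `y ^ a / a`, and `a *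
  -- Γ(a) = Γ(a + 1)` produces the density of shape `a + 1`.
  set φ : ℝ → ℝ≥0∞ := (Set.Ioi 0).indicator
    fun t => ENNReal.ofReal (r ^ a / Real.Gamma a * t ^ (a - 1)) with hφ
  have hφm : Measurable φ := Measurable.indicator (by fun_prop) measurableSet_Ioi
  have hinner (t : ℝ) : ∫⁻ y in Set.Ioi t, f y ∂expMeasure r =
      ∫⁻ y, (Set.Ioi t).indicator (fun y => gammaPDF 1 r y * f y) y := by
    rw [← lintegral_indicator measurableSet_Ioi, expMeasure, lintegral_gammaMeasure]
    refine lintegral_congr fun y => ?_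
    by_cases h : y ∈ Set.Ioi t <;> simp [h]
  have hpdf : Measurable fun y => gammaPDF 1 r y * f y := (measurable_gammaPDF 1 r).mul hf
  calc _ = ∫⁻ t, φ t * ∫⁻ y, (Set.Ioi t).indicator (fun y => gammaPDF 1 r y * f y) y := by
        rw [lintegral_gammaMeasure]
        refine lintegral_congr_of_ne_zero (fun t ht => ?_) fun t ht => ?_
        · simp [φ, gammaPDF_of_neg ht, ht.le]
        · rw [hinner, ← mul_assoc, expMeasure_Ioi hr ht.le, gammaPDF_of_nonneg ht.le, hφ,
            Set.indicator_of_mem (Set.mem_Ioi.2 ht), ← ENNReal.ofReal_inv_of_pos (Real.exp_pos _),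
            ← ENNReal.ofReal_mul (by positivity), mul_assoc _ (Real.exp _) _,
            mul_inv_cancel₀ (Real.exp_pos _).ne', mul_one]
    _ = ∫⁻ t, ∫⁻ y, φ t * (Set.Ioi t).indicator (fun y => gammaPDF 1 r y * f y) y := by
        refine lintegral_congr fun t => ?_
        rw [lintegral_const_mul _ (hpdf.indicator measurableSet_Ioi)]
    _ = ∫⁻ y, ∫⁻ t, φ t * (Set.Ioi t).indicator (fun y => gammaPDF 1 r y * f y) y := by
        refine lintegral_lintegral_swap (Measurable.aemeasurable ?_)
        refine (hφm.comp measurable_fst).mul ?_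
        exact Measurable.indicator (s := {p : ℝ × ℝ | p.1 < p.2}) (hpdf.comp measurable_snd)
          (measurableSet_lt measurable_fst measurable_snd)
    _ = ∫⁻ y, gammaPDF 1 r y * f y * ∫⁻ t in Set.Ioo 0 y,
          ENNReal.ofReal (r ^ a / Real.Gamma a * t ^ (a - 1)) := by
        refine lintegral_congr fun y => ?_
        rw [← lintegral_indicator measurableSet_Ioo, ← lintegral_const_mul _
          (Measurable.indicator (by fun_prop) measurableSet_Ioo)]
        refine lintegral_congr fun t => ?_
        by_cases h1 : 0 < t <;> by_cases h2 : t < y <;> simp [φ, h1, h2, mul_comm]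
    _ = _ := by
        rw [lintegral_gammaMeasure]
        refine lintegral_congr_of_ne_zero (fun y hy => ?_) fun y hy => ?_
        · simp [gammaPDF_of_neg hy]
        · rw [setLIntegral_congr Ioo_ae_eq_Ioc, setLIntegral_rpow ha (by positivity) hy.le,
            mul_right_comm, gammaPDF_of_nonneg hy.le, gammaPDF_of_nonneg hy.le,
            ← ENNReal.ofReal_mul (by simp; positivity), Real.Gamma_add_one ha.ne',
            Real.rpow_add hr]
          congr 2
          simp
          field_simp

/-- Size biasing: `u ^ a` times the density of shape `p` is proportional to the density of shape `p
+ a`. -/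
lemma lintegral_pow_mul_gammaMeasure {p r : ℝ} (hp : 0 < p) (hr : 0 < r) (a : ℕ)
    (f : ℝ → ℝ≥0∞) :
    ∫⁻ u, ENNReal.ofReal (u ^ a) * f u ∂gammaMeasure p r =
      ENNReal.ofReal (Real.Gamma (p + a) / (Real.Gamma p * r ^ a)) *
        ∫⁻ u, f u ∂gammaMeasure (p + a) r := by
  have hG : 0 < Real.Gamma p := Real.Gamma_pos_of_pos hp
  have hG' : 0 < Real.Gamma (p + a) := Real.Gamma_pos_of_pos (by positivity)
  rw [lintegral_gammaMeasure, lintegral_gammaMeasure, ← lintegral_const_mul' _ _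
    ENNReal.ofReal_ne_top]
  refine lintegral_congr_of_ne_zero (fun u hu => ?_) fun u hu => ?_
  · simp [gammaPDF_of_neg hu]
  · rw [← mul_assoc, ← mul_assoc, gammaPDF_of_nonneg hu.le, gammaPDF_of_nonneg hu.le,
      ← ENNReal.ofReal_mul (by positivity), ← ENNReal.ofReal_mul (by positivity)]
    congr 2
    rw [show p + a - 1 = p - 1 + a by ring, Real.rpow_add hu, Real.rpow_add hr, Real.rpow_natCast,
      Real.rpow_natCast]
    field_simp

/-! ### The gamma law of exponential records. -/

section RecordLaw

lemma lintegral_tsum_recordWeight_gamma {Ω : Type*} [MeasurableSpace Ω] {μ : Measure Ω}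
    [IsProbabilityMeasure μ] {X : ℕ → Ω → ℝ} {r : ℝ} (hr : 0 < r)
    (hX : ∀ i, StronglyMeasurable (X i)) (hi : iIndepFun X μ)
    (hν : ∀ i, μ.map (X i) = expMeasure r) (k : ℕ) {f : ℝ → ℝ≥0∞} (hf : Measurable f) :
    ∫⁻ ω, ∑' i, recordWeight (fun j => X j ω) k i * f (X i ω) ∂μ =
      ∫⁻ y, f y ∂gammaMeasure (k + 1 : ℕ) r := by
  induction k generalizing f with
  | zero =>
    have h (ω : Ω) : ∑' i, recordWeight (fun j => X j ω) 0 i * f (X i ω) = f (X 0 ω) := by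
      rw [tsum_eq_single 0]
      · simp [recordWeight]
      · rintro (_ | i) hi
        · exact absurd rfl hi
        · simp [recordWeight]
    simp_rw [h]
    rw [← lintegral_map hf (hX 0).measurable, hν]
    simp [expMeasure]
  | succ k ih =>
    have hG : Measurable fun t => expMeasure r (Set.Ioi t) :=
      Antitone.measurable fun s t h => measure_mono (Set.Ioi_subset_Ioi h)
    have hq : Measurable fun t => ∫⁻ y in Set.Ioi t, f y ∂expMeasure r :=
      Antitone.measurable fun s t h => lintegral_mono_set (Set.Ioi_subset_Ioi h)
    rw [lintegral_tsum_recordWeight_succ hX hi hν k hf,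
      ih (f := fun t => (expMeasure r (Set.Ioi t))⁻¹ * ∫⁻ y in Set.Ioi t, f y ∂expMeasure r)
        (hG.inv.mul hq), lintegral_gammaMeasure_succ (by positivity) hr hf]
    push_cast
    rfl

lemma map_upperRecord_infinitePi {r : ℝ} (hr : 0 < r) {n : ℕ} (hn : 1 ≤ n) :
    (Measure.infinitePi fun _ : ℕ => expMeasure r).map (fun x => upperRecord x n) =
      gammaMeasure n r := by
  have := isProbabilityMeasure_expMeasure hr
  have := isProbabilityMeasure_gammaMeasure (a := n) (by positivity) hr
  have := Measure.isProbabilityMeasure_map (μ := Measure.infinitePi fun _ : ℕ => expMeasure r)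
    (measurable_upperRecord n).aemeasurable
  obtain ⟨k, rfl⟩ : ∃ k, n = k + 1 := ⟨n - 1, by omega⟩
  -- The weights give the gamma measure as a lower bound for the law of the record. Both have mass
  -- one, so they agree; almost sure existence of every record needs no separate argument.
  refine (Measure.eq_of_le_of_isProbabilityMeasure (Measure.le_iff.2 fun s hs => ?_)).symm
  have hf : Measurable (s.indicator (1 : ℝ → ℝ≥0∞)) := measurable_one.indicator hs
  have h := lintegral_tsum_recordWeight_gamma hr
    (μ := Measure.infinitePi fun _ : ℕ => expMeasure r) (X := fun i x => x i)
    (fun i => (measurable_pi_apply i).stronglyMeasurable)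
    (iIndepFun_infinitePi (X := fun _ x => x) fun _ => measurable_id)
    (fun i => Measure.infinitePi_map_eval _ i) k hf
  rw [← lintegral_indicator_one hs, ← lintegral_indicator_one hs, ← h,
    lintegral_map hf (measurable_upperRecord _)]
  exact lintegral_mono fun x => tsum_recordWeight_mul_le x k _

/-- The `n`-th upper record value of an i.i.d. exponential sequence is gamma distributed. -/
lemma hasLaw_upperRecord {Ω : Type*} [MeasurableSpace Ω] {μ : Measure Ω} {X : ℕ → Ω → ℝ} {r : ℝ}
    (hr : 0 < r) (hX : ∀ i, HasLaw (X i) (expMeasure r) μ) (hi : iIndepFun X μ) {n : ℕ}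
    (hn : 1 ≤ n) :
    HasLaw (fun ω => upperRecord (fun i => X i ω) n) (gammaMeasure n r) μ :=
  HasLaw.fun_comp (Y := fun x => upperRecord x n)
    ⟨(measurable_upperRecord n).aemeasurable, map_upperRecord_infinitePi hr hn⟩
    (hi.hasLaw_infinitePi hX (aemeasurable_pi_iff.2 fun i => (hX i).aemeasurable))

end RecordLaw

/-! ### The ratio of two independent gamma variables. -/

section BetaGamma

/-- The density of the ratio at `z`. As a function of `v` the integrand is a multiple of the gamma
density of shape `p + q` and rate `r₂ + z * r₁`, whose total mass is one. -/
lemma lintegral_mul_gammaPDF_mul_gammaPDF {p q r₁ r₂ z : ℝ} (hp : 0 < p) (hq : 0 < q)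
    (hr₁ : 0 < r₁) (hr₂ : 0 < r₂) (hz : 0 < z) :
    ∫⁻ v, gammaPDF q r₂ v * (ENNReal.ofReal v * gammaPDF p r₁ (v * z)) =
      ENNReal.ofReal (r₁ ^ p * r₂ ^ q * z ^ (p - 1) / (beta p q * (r₂ + z * r₁) ^ (p + q))) := by
  have hGp : 0 < Real.Gamma p := Real.Gamma_pos_of_pos hp
  have hGq : 0 < Real.Gamma q := Real.Gamma_pos_of_pos hq
  have hGpq : 0 < Real.Gamma (p + q) := Real.Gamma_pos_of_pos (by positivity)
  have hR : 0 < r₂ + z * r₁ := by positivity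
  have hB := beta_pos hp hq
  rw [← mul_one (ENNReal.ofReal _), ← lintegral_gammaPDF_eq_one (add_pos hp hq) hR,
    ← lintegral_const_mul' _ _ ENNReal.ofReal_ne_top]
  refine lintegral_congr_of_ne_zero (fun v hv => ?_) fun v hv => ?_
  · simp [gammaPDF_of_neg hv]
  · rw [gammaPDF_of_nonneg hv.le, gammaPDF_of_nonneg hv.le, gammaPDF_of_nonneg (by positivity),
      ← ENNReal.ofReal_mul (by positivity), ← ENNReal.ofReal_mul (by positivity),
      ← ENNReal.ofReal_mul (by positivity)]
    congr 1
    rw [Real.mul_rpow hv.le hz.le, show p + q - 1 = (q - 1) + (p - 1) + 1 by ring,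
      Real.rpow_add hv, Real.rpow_add hv, Real.rpow_one,
      show -((r₂ + z * r₁) * v) = -(r₂ * v) + -(r₁ * (v * z)) by ring, Real.exp_add, beta]
    field_simp

lemma lintegral_Iic_mul_gammaPDF {p r v s : ℝ} (hv : 0 < v) :
    ∫⁻ u in Set.Iic (s * v), gammaPDF p r u =
      ∫⁻ z in Set.Iic s, ENNReal.ofReal v * gammaPDF p r (v * z) := by
  rw [← lintegral_indicator measurableSet_Iic, ← lintegral_indicator measurableSet_Iic]
  conv_lhs => rw [← Real.smul_map_volume_mul_left hv.ne']
  rw [lintegral_smul_measure, lintegral_map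
    ((measurable_gammaPDF p r).indicator measurableSet_Iic) (measurable_const_mul v),
    abs_of_pos hv, smul_eq_mul, ← lintegral_const_mul' _ _ ENNReal.ofReal_ne_top]
  refine lintegral_congr fun z => ?_
  have : v * z ≤ s * v ↔ z ≤ s := by rw [mul_comm s v]; exact mul_le_mul_iff_right₀ hv
  by_cases h : z ≤ s <;> simp [h, this]

/-- Substitution `x = z * r₁ / (r₂ + z * r₁)`, written as `1 - r₂ / (r₂ + z * r₁)`. The bounds `1 ≤
p`, `1 ≤ q` make the beta integrand continuous everywhere. -/
lemma integral_betaPrime_eq_incBeta {p q r₁ r₂ s : ℝ} (hp : 1 ≤ p) (hq : 1 ≤ q)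
    (hr₁ : 0 < r₁) (hr₂ : 0 < r₂) (hs : 0 ≤ s) :
    ∫ z in (0 : ℝ)..s, r₁ ^ p * r₂ ^ q * z ^ (p - 1) / (beta p q * (r₂ + z * r₁) ^ (p + q)) =
      incBeta (1 - r₂ / (r₂ + s * r₁)) p q := by
  have hB := beta_pos (by linarith : 0 < p) (by linarith : 0 < q)
  have hR (z : ℝ) (hz : z ∈ Set.uIcc 0 s) : 0 ≤ z ∧ 0 < r₂ + z * r₁ := by
    rw [Set.uIcc_of_le hs] at hz
    have := hz.1
    exact ⟨this, by positivity⟩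
  have hg : Continuous fun x : ℝ => x ^ (p - 1) * (1 - x) ^ (q - 1) :=
    (Real.continuous_rpow_const (by linarith)).mul
      ((Real.continuous_rpow_const (by linarith)).comp (continuous_const.sub continuous_id))
  have hsub := intervalIntegral.integral_comp_mul_deriv (a := 0) (b := s)
    (f := fun z => 1 - r₂ / (r₂ + z * r₁)) (f' := fun z => r₁ * r₂ / (r₂ + z * r₁) ^ 2)
    (fun z hz => by
      have h := (hR z hz).2
      have h1 : HasDerivAt (fun z => r₂ + z * r₁) r₁ z := by
        simpa using ((hasDerivAt_id z).mul_const r₁).const_add r₂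
      refine (((hasDerivAt_const z r₂).fun_div h1 h.ne').const_sub 1).congr_deriv ?_
      ring)
    (ContinuousOn.div (by fun_prop) (by fun_prop)
      fun z hz => (pow_pos (hR z hz).2 2).ne') hg
  simp only [zero_mul, add_zero, div_self hr₂.ne', sub_self] at hsub
  rw [incBeta, ← hsub, div_eq_inv_mul, ← intervalIntegral.integral_const_mul]
  refine intervalIntegral.integral_congr fun z hz => ?_
  obtain ⟨hz0, hz⟩ := hR z hz
  have e1 : 1 - r₂ / (r₂ + z * r₁) = z * r₁ / (r₂ + z * r₁) := by field_simp; ring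
  have e2 : 1 - (1 - r₂ / (r₂ + z * r₁)) = r₂ / (r₂ + z * r₁) := by ring
  simp only [Function.comp_apply]
  rw [e2, e1, Real.div_rpow (by positivity) hz.le, Real.div_rpow hr₂.le hz.le,
    Real.mul_rpow hz0 hr₁.le, show p + q = (p - 1) + (q - 1) + 2 by ring, Real.rpow_add hz,
    Real.rpow_add hz, Real.rpow_sub_one hr₁.ne', Real.rpow_sub_one hr₂.ne', Real.rpow_two]
  field_simp

/-- The distribution function of the ratio: with the denominator `v` fixed, put `u = v * z`, swap
the integrals, and integrate the beta prime density over `(0, s]`. -/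
lemma gammaMeasure_prod_le_mul {p q r₁ r₂ s : ℝ} (hp : 1 ≤ p) (hq : 1 ≤ q)
    (hr₁ : 0 < r₁) (hr₂ : 0 < r₂) (hs : 0 ≤ s) :
    ((gammaMeasure p r₁).prod (gammaMeasure q r₂)) {z | z.1 ≤ s * z.2} =
      ENNReal.ofReal (incBeta (1 - r₂ / (r₂ + s * r₁)) p q) := by
  have hp0 : 0 < p := by linarith
  have hq0 : 0 < q := by linarith
  have := isProbabilityMeasure_gammaMeasure hp0 hr₁
  have := isProbabilityMeasure_gammaMeasure hq0 hr₂
  have hB := beta_pos hp0 hq0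
  rw [Measure.prod_apply_symm (measurableSet_le measurable_fst (measurable_snd.const_mul s)),
    lintegral_gammaMeasure]
  calc _ = ∫⁻ v, ∫⁻ z in Set.Iic s, gammaPDF q r₂ v *
            (ENNReal.ofReal v * gammaPDF p r₁ (v * z)) := by
        refine lintegral_congr_of_ne_zero (fun v hv => ?_) fun v hv => ?_
        · simp [gammaPDF_of_neg hv]
        · rw [lintegral_const_mul' (gammaPDF q r₂ v) _ ENNReal.ofReal_ne_top,
            ← lintegral_Iic_mul_gammaPDF hv,
            ← withDensity_apply _ measurableSet_Iic]
          rfl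
    _ = ∫⁻ z in Set.Iic s, ∫⁻ v, gammaPDF q r₂ v *
            (ENNReal.ofReal v * gammaPDF p r₁ (v * z)) := by
        refine lintegral_lintegral_swap (Measurable.aemeasurable ?_)
        exact ((measurable_gammaPDF q r₂).comp measurable_fst).mul
          (measurable_fst.ennreal_ofReal.mul ((measurable_gammaPDF p r₁).comp
            (measurable_fst.mul measurable_snd)))
    _ = ∫⁻ z in Set.Ioc 0 s, ENNReal.ofReal
          (r₁ ^ p * r₂ ^ q * z ^ (p - 1) / (beta p q * (r₂ + z * r₁) ^ (p + q))) := by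
        rw [← lintegral_indicator measurableSet_Iic, ← lintegral_indicator measurableSet_Ioc]
        refine lintegral_congr_of_ne_zero (fun z hz => ?_) fun z hz => ?_
        · rw [Set.indicator_of_notMem (s := Set.Ioc 0 s) (fun h => absurd h.1 hz.not_gt)]
          refine Set.indicator_apply_eq_zero.2 fun _ => ?_
          rw [lintegral_congr_of_ne_zero (g := 0) (fun v hv => ?_) fun v hv => ?_]
          · simp
          · simp [gammaPDF_of_neg hv]
          · simp [gammaPDF_of_neg (mul_neg_of_pos_of_neg hv hz)]
        · by_cases h : z ≤ s
          · rw [Set.indicator_of_mem (Set.mem_Iic.2 h), Set.indicator_of_mem (Set.mem_Ioc.2 ⟨hz, h⟩),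
              lintegral_mul_gammaPDF_mul_gammaPDF hp0 hq0 hr₁ hr₂ hz]
          · rw [Set.indicator_of_notMem (by simpa using h),
              Set.indicator_of_notMem (fun h' => h h'.2)]
    _ = _ := by
        rw [← integral_betaPrime_eq_incBeta hp hq hr₁ hr₂ hs, intervalIntegral.integral_of_le hs,
          ofReal_integral_eq_lintegral_ofReal]
        · refine (intervalIntegrable_iff_integrableOn_Ioc_of_le hs).1
            (ContinuousOn.intervalIntegrable ?_)
          rw [Set.uIcc_of_le hs]
          have hR (z : ℝ) (hz : z ∈ Set.Icc 0 s) : 0 < r₂ + z * r₁ := by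
            have := hz.1
            positivity
          refine ContinuousOn.div ?_ ?_ fun z hz => ?_
          · exact continuousOn_const.mul
              (Real.continuous_rpow_const (by linarith)).continuousOn
          · exact continuousOn_const.mul (ContinuousOn.rpow_const (by fun_prop)
              fun z hz => Or.inl (hR z hz).ne')
          · have := hR z hz
            positivity
        · refine (ae_restrict_iff' measurableSet_Ioc).2 (ae_of_all _ fun z hz => ?_)
          have := hz.1
          positivity

end BetaGamma

end RecordPT

/-! ### Probability of the acceptance region and truncated moments. -/

namespace RecordPT

open scoped ENNReal

lemma ae_pos_gammaMeasure (p r : ℝ) : ∀ᵐ u ∂gammaMeasure p r, 0 < u := by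
  rw [gammaMeasure, ae_withDensity_iff (measurable_gammaPDF p r)]
  filter_upwards [compl_mem_ae_iff.2 (measure_singleton (0 : ℝ))] with x hx hpdf
  by_contra! hc
  exact hpdf (gammaPDF_of_neg (lt_of_le_of_ne hc hx))

lemma ae_pos_gammaMeasure_prod {p q r₁ r₂ : ℝ} (hp : 0 < p) (hq : 0 < q) (hr₁ : 0 < r₁)
    (hr₂ : 0 < r₂) :
    ∀ᵐ z ∂(gammaMeasure p r₁).prod (gammaMeasure q r₂), 0 < z.1 ∧ 0 < z.2 := by
  have := isProbabilityMeasure_gammaMeasure hp hr₁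
  have := isProbabilityMeasure_gammaMeasure hq hr₂
  filter_upwards [Measure.quasiMeasurePreserving_fst.ae (ae_pos_gammaMeasure p r₁),
    Measure.quasiMeasurePreserving_snd.ae (ae_pos_gammaMeasure q r₂)] with z h1 h2
  exact ⟨h1, h2⟩

/-- Each section at fixed `z.2` is a single point, null for the gamma law. This removes the
difference between `<` and `≤` at the critical value `c₂`. -/
lemma ae_ne_mul_gammaMeasure_prod {p q r₁ r₂ : ℝ} (hp : 0 < p) (hq : 0 < q) (hr₁ : 0 < r₁)
    (hr₂ : 0 < r₂) (s : ℝ) :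
    ∀ᵐ z ∂(gammaMeasure p r₁).prod (gammaMeasure q r₂), z.1 ≠ s * z.2 := by
  have := isProbabilityMeasure_gammaMeasure hp hr₁
  have := isProbabilityMeasure_gammaMeasure hq hr₂
  rw [ae_iff]
  simp only [ne_eq, not_not]
  rw [Measure.prod_apply_symm (measurableSet_eq_fun measurable_fst (measurable_snd.const_mul s))]
  refine lintegral_eq_zero_of_ae_eq_zero (ae_of_all _ fun v => ?_)
  exact withDensity_absolutelyContinuous _ _ (measure_singleton (s * v))

lemma incBeta_nonneg {p q r₁ r₂ s : ℝ} (hp : 1 ≤ p) (hq : 1 ≤ q)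
    (hr₁ : 0 < r₁) (hr₂ : 0 < r₂) (hs : 0 ≤ s) : 0 ≤ incBeta (1 - r₂ / (r₂ + s * r₁)) p q := by
  have hB := beta_pos (by linarith : 0 < p) (by linarith : 0 < q)
  rw [← integral_betaPrime_eq_incBeta hp hq hr₁ hr₂ hs]
  refine intervalIntegral.integral_nonneg hs fun z hz => ?_
  have := hz.1
  positivity

/-- The acceptance region of the preliminary test, in terms of the two record values. -/
def acceptRegion (n₁ n₂ : ℕ) (c₁ c₂ : ℝ) : Set (ℝ × ℝ) :=
  {z | c₁ < z.1 / n₁ / (z.2 / n₂) ∧ z.1 / n₁ / (z.2 / n₂) < c₂}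

lemma measurableSet_acceptRegion (n₁ n₂ : ℕ) (c₁ c₂ : ℝ) :
    MeasurableSet (acceptRegion n₁ n₂ c₁ c₂) := by
  have h : Measurable fun z : ℝ × ℝ => z.1 / n₁ / (z.2 / n₂) := by fun_prop
  exact (measurableSet_lt measurable_const h).inter (measurableSet_lt h measurable_const)

lemma measureReal_acceptRegion {p q θ₁ θ₂ : ℝ} (hp : 1 ≤ p) (hq : 1 ≤ q) (hθ₁ : 0 < θ₁)
    (hθ₂ : 0 < θ₂) {n₁ n₂ : ℕ} (hn₁ : 1 ≤ n₁) (hn₂ : 1 ≤ n₂) {c₁ c₂ : ℝ} (hc₁ : 0 ≤ c₁)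
    (hc : c₁ ≤ c₂) :
    ((gammaMeasure p (1 / θ₁)).prod (gammaMeasure q (1 / θ₂))).real (acceptRegion n₁ n₂ c₁ c₂) =
      incBeta (1 - n₂ / (n₂ + c₂ * n₁ * (θ₂ / θ₁))) p q -
        incBeta (1 - n₂ / (n₂ + c₁ * n₁ * (θ₂ / θ₁))) p q := by
  have hp0 : 0 < p := by linarith
  have hq0 : 0 < q := by linarith
  have hr₁ : 0 < 1 / θ₁ := by positivity
  have hr₂ : 0 < 1 / θ₂ := by positivity
  have hN₁ : (0 : ℝ) < n₁ := by positivity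
  have hN₂ : (0 : ℝ) < n₂ := by positivity
  have := isProbabilityMeasure_gammaMeasure hp0 hr₁
  have := isProbabilityMeasure_gammaMeasure hq0 hr₂
  -- The condition `0 < z.2` costs only a null set and makes the regions for `c₁ ≤ c₂` nested
  -- pointwise, as the measure of their difference requires.
  have hle (c : ℝ) (h : 0 ≤ c) :
      ((gammaMeasure p (1 / θ₁)).prod (gammaMeasure q (1 / θ₂))).real
        {z | 0 < z.2 ∧ z.1 ≤ c * n₁ / n₂ * z.2} = incBeta (1 - n₂ / (n₂ + c * n₁ * (θ₂ / θ₁))) p q := by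
    have hs : 0 ≤ c * n₁ / n₂ := by positivity
    have hpos : ({z | 0 < z.2 ∧ z.1 ≤ c * n₁ / n₂ * z.2} : Set (ℝ × ℝ))
        =ᵐ[(gammaMeasure p (1 / θ₁)).prod (gammaMeasure q (1 / θ₂))]
        {z | z.1 ≤ c * n₁ / n₂ * z.2} := by
      filter_upwards [ae_pos_gammaMeasure_prod hp0 hq0 hr₁ hr₂] with z hz
      exact propext (and_iff_right hz.2)
    rw [measureReal_congr hpos, measureReal_def, gammaMeasure_prod_le_mul hp hq hr₁ hr₂ hs,
      ENNReal.toReal_ofReal (incBeta_nonneg hp hq hr₁ hr₂ hs)]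
    congr 2
    have : 0 ≤ c * n₁ * (θ₂ / θ₁) := by positivity
    have : 0 ≤ c * n₁ := by positivity
    field_simp
  have hc₂ := hc₁.trans hc
  rw [← hle c₁ hc₁, ← hle c₂ hc₂, ← measureReal_sdiff]
  · refine measureReal_congr ?_
    filter_upwards [ae_pos_gammaMeasure_prod hp0 hq0 hr₁ hr₂,
      ae_ne_mul_gammaMeasure_prod hp0 hq0 hr₁ hr₂ (c₂ * n₁ / n₂)] with z hz hne
    have e : z.1 / n₁ / (z.2 / n₂) = z.1 / (n₁ / n₂ * z.2) := by
      have := hz.2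
      field_simp
    have hd : 0 < n₁ / n₂ * z.2 := mul_pos (by positivity) hz.2
    refine propext ?_
    change (c₁ < z.1 / n₁ / (z.2 / n₂) ∧ z.1 / n₁ / (z.2 / n₂) < c₂) ↔
      ((0 < z.2 ∧ z.1 ≤ c₂ * n₁ / n₂ * z.2) ∧ ¬ (0 < z.2 ∧ z.1 ≤ c₁ * n₁ / n₂ * z.2))
    rw [and_iff_right hz.2, and_iff_right hz.2, e, lt_div_iff₀ hd, div_lt_iff₀ hd, not_le, and_comm, ← mul_assoc, ← mul_assoc,
      ← mul_div_assoc, ← mul_div_assoc, le_iff_lt_or_eq, or_iff_left hne]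
  · rintro z ⟨h1, h2⟩
    exact ⟨h1, h2.trans (by gcongr)⟩
  · exact (measurableSet_lt measurable_const measurable_snd).inter
      (measurableSet_le measurable_fst (measurable_snd.const_mul _))

/-- `f` is integrable with integral `c`. -/
def HasMean {α : Type*} [MeasurableSpace α] (π : Measure α) (f : α → ℝ) (c : ℝ) : Prop :=
  Integrable f π ∧ ∫ x, f x ∂π = c

namespace HasMean

variable {α : Type*} [MeasurableSpace α] {π : Measure α} {f g : α → ℝ} {a b : ℝ}

lemma add (hf : HasMean π f a) (hg : HasMean π g b) : HasMean π (fun x => f x + g x) (a + b) :=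
  ⟨hf.1.add hg.1, by rw [integral_add hf.1 hg.1, hf.2, hg.2]⟩

lemma const_mul (hf : HasMean π f a) (c : ℝ) : HasMean π (fun x => c * f x) (c * a) :=
  ⟨hf.1.const_mul c, by rw [integral_const_mul, hf.2]⟩

lemma const [IsProbabilityMeasure π] (c : ℝ) : HasMean π (fun _ => c) c :=
  ⟨integrable_const c, by simp⟩

lemma congr (hf : HasMean π f a) (hfg : ∀ x, g x = f x) (hab : b = a) : HasMean π g b := by
  rwa [show g = f from funext hfg, hab]

lemma comp_hasLaw {Ω : Type*} [MeasurableSpace Ω] {μ : Measure Ω} {W : Ω → α}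
    (hf : HasMean π f a) (hW : HasLaw W π μ) : HasMean μ (fun ω => f (W ω)) a := by
  have hf' := hf
  rw [← hW.map_eq] at hf'
  exact ⟨hf'.1.comp_aemeasurable hW.aemeasurable,
    (integral_map hW.aemeasurable hf'.1.aestronglyMeasurable).symm.trans hf'.2⟩

end HasMean

/-- Size biasing is applied in each coordinate under Tonelli; the indicator of `A` is carried along
unchanged. -/
lemma hasMean_indicator_pow_mul_pow {p q r₁ r₂ : ℝ} (hp : 0 < p) (hq : 0 < q) (hr₁ : 0 < r₁)
    (hr₂ : 0 < r₂) (a b : ℕ) {A : Set (ℝ × ℝ)} (hA : MeasurableSet A) :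
    HasMean ((gammaMeasure p r₁).prod (gammaMeasure q r₂))
      (A.indicator fun z => z.1 ^ a * z.2 ^ b)
      (Real.Gamma (p + a) / (Real.Gamma p * r₁ ^ a) *
        (Real.Gamma (q + b) / (Real.Gamma q * r₂ ^ b)) *
        ((gammaMeasure (p + a) r₁).prod (gammaMeasure (q + b) r₂)).real A) := by
  have hpa : 0 < p + a := by positivity
  have hqb : 0 < q + b := by positivity
  have := isProbabilityMeasure_gammaMeasure hp hr₁
  have := isProbabilityMeasure_gammaMeasure hq hr₂
  have := isProbabilityMeasure_gammaMeasure hpa hr₁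
  have := isProbabilityMeasure_gammaMeasure hqb hr₂
  have hK {p r : ℝ} (hp : 0 < p) (hr : 0 < r) (a : ℕ) :
      0 ≤ Real.Gamma (p + a) / (Real.Gamma p * r ^ a) := by
    have := Real.Gamma_pos_of_pos hp
    have := Real.Gamma_pos_of_pos (show 0 < p + a by positivity)
    positivity
  set π := (gammaMeasure p r₁).prod (gammaMeasure q r₂) with hπ
  set K₁ := Real.Gamma (p + a) / (Real.Gamma p * r₁ ^ a)
  set K₂ := Real.Gamma (q + b) / (Real.Gamma q * r₂ ^ b)
  have hmeas : Measurable (A.indicator fun z : ℝ × ℝ => z.1 ^ a * z.2 ^ b) :=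
    Measurable.indicator (by fun_prop) hA
  have hone : Measurable (A.indicator (1 : ℝ × ℝ → ℝ≥0∞)) := measurable_one.indicator hA
  have hpos := ae_pos_gammaMeasure_prod hp hq hr₁ hr₂
  have hnn : 0 ≤ᵐ[π] A.indicator fun z => z.1 ^ a * z.2 ^ b := by
    filter_upwards [hpos] with z hz
    have := hz.1
    have := hz.2
    exact Set.indicator_apply_nonneg fun _ => by positivity
  have hlint : ∫⁻ z, ENNReal.ofReal (A.indicator (fun z => z.1 ^ a * z.2 ^ b) z) ∂π =
      ENNReal.ofReal K₁ * (ENNReal.ofReal K₂ *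
        ((gammaMeasure (p + a) r₁).prod (gammaMeasure (q + b) r₂)) A) := by
    calc _ = ∫⁻ z, ENNReal.ofReal (z.1 ^ a) *
            (ENNReal.ofReal (z.2 ^ b) * A.indicator 1 z) ∂π := by
          refine lintegral_congr_ae ?_
          filter_upwards [hpos] with z hz
          have := hz.1
          by_cases h : z ∈ A
          · simp [h, ENNReal.ofReal_mul (show 0 ≤ z.1 ^ a by positivity)]
          · simp [h]
      _ = ∫⁻ u, ENNReal.ofReal (u ^ a) * (ENNReal.ofReal K₂ *
            ∫⁻ v, A.indicator 1 (u, v) ∂gammaMeasure (q + b) r₂) ∂gammaMeasure p r₁ := by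
          rw [hπ, lintegral_prod]
          · refine lintegral_congr fun u => ?_
            dsimp only
            rw [lintegral_const_mul' _ _ ENNReal.ofReal_ne_top,
              lintegral_pow_mul_gammaMeasure hq hr₂]
          · exact ((measurable_fst.pow_const a).ennreal_ofReal.mul
              ((measurable_snd.pow_const b).ennreal_ofReal.mul hone)).aemeasurable
      _ = _ := by
          rw [lintegral_pow_mul_gammaMeasure hp hr₁,
            lintegral_const_mul' _ _ ENNReal.ofReal_ne_top, ← lintegral_prod _ hone.aemeasurable,
            lintegral_indicator_one hA]
  refine ⟨⟨hmeas.aestronglyMeasurable, ?_⟩, ?_⟩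
  · rw [hasFiniteIntegral_iff_ofReal hnn, hlint]
    exact ENNReal.mul_lt_top ENNReal.ofReal_lt_top
      (ENNReal.mul_lt_top ENNReal.ofReal_lt_top (measure_lt_top _ _))
  · rw [integral_eq_lintegral_of_nonneg_ae hnn hmeas.aestronglyMeasurable, hlint,
      ENNReal.toReal_mul, ENNReal.toReal_mul, ENNReal.toReal_ofReal (hK hp hr₁ a),
      ENNReal.toReal_ofReal (hK hq hr₂ b), measureReal_def, mul_assoc]

end RecordPT

/-! ### The estimator as a function of two independent gammas. -/

namespace RecordPT

/-- The preliminary test estimator as a function of the two record values. -/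
noncomputable def prelimTestFun (n₁ n₂ : ℕ) (c₁ c₂ : ℝ) (z : ℝ × ℝ) : ℝ :=
  z.1 / n₁ + (acceptRegion n₁ n₂ c₁ c₂).indicator
    (fun z => (n₂ : ℝ) / (n₁ + n₂) * (z.2 / n₂ - z.1 / n₁)) z

/-- The pooled estimator is `θ̂₁ + λ (θ̂₂ - θ̂₁)`, so acceptance only adds a correction term. -/
lemma prelimTestEst_eq {n₁ n₂ : ℕ} (hn₁ : 1 ≤ n₁) (hn₂ : 1 ≤ n₂) (c₁ c₂ : ℝ) (x y : ℕ → ℝ) :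
    prelimTestEst n₁ n₂ c₁ c₂ x y =
      prelimTestFun n₁ n₂ c₁ c₂ (upperRecord x n₁, upperRecord y n₂) := by
  have hN₁ : (0 : ℝ) < n₁ := by positivity
  have hN₂ : (0 : ℝ) < n₂ := by positivity
  unfold prelimTestEst prelimTestFun
  split_ifs with h
  · rw [Set.indicator_of_mem (show (upperRecord x n₁, upperRecord y n₂) ∈
      acceptRegion n₁ n₂ c₁ c₂ from h), pooledEst, scaleEst, scaleEst]
    field_simp
    ring
  · rw [Set.indicator_of_notMem (show (upperRecord x n₁, upperRecord y n₂) ∉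
      acceptRegion n₁ n₂ c₁ c₂ from h), add_zero, scaleEst]

lemma hasLaw_prodMk_upperRecord {Ω : Type*} [MeasurableSpace Ω] {μ : Measure Ω}
    [IsProbabilityMeasure μ] {X Y : ℕ → Ω → ℝ} {r₁ r₂ : ℝ} (hr₁ : 0 < r₁) (hr₂ : 0 < r₂)
    (hX : ∀ i, HasLaw (X i) (expMeasure r₁) μ) (hY : ∀ i, HasLaw (Y i) (expMeasure r₂) μ)
    (hXi : iIndepFun X μ) (hYi : iIndepFun Y μ)
    (hXY : IndepFun (fun ω i => X i ω) (fun ω i => Y i ω) μ) {n₁ n₂ : ℕ} (hn₁ : 1 ≤ n₁)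
    (hn₂ : 1 ≤ n₂) :
    HasLaw (fun ω => (upperRecord (fun i => X i ω) n₁, upperRecord (fun i => Y i ω) n₂))
      ((gammaMeasure n₁ r₁).prod (gammaMeasure n₂ r₂)) μ := by
  have hU := hasLaw_upperRecord hr₁ hX hXi hn₁
  have hV := hasLaw_upperRecord hr₂ hY hYi hn₂
  refine ⟨hU.aemeasurable.prodMk hV.aemeasurable, ?_⟩
  have hind := hXY.comp (measurable_upperRecord n₁) (measurable_upperRecord n₂)
  rw [← hU.map_eq, ← hV.map_eq]
  exact hind.map_prod_eq_prod_map_map hU.aemeasurable hV.aemeasurable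

lemma hasMean_acceptRegion_pow_mul_pow {θ₁ θ₂ : ℝ} (hθ₁ : 0 < θ₁) (hθ₂ : 0 < θ₂) {n₁ n₂ : ℕ}
    (hn₁ : 1 ≤ n₁) (hn₂ : 1 ≤ n₂) {c₁ c₂ : ℝ} (hc₁ : 0 ≤ c₁) (hc : c₁ ≤ c₂) (a b : ℕ) :
    HasMean ((gammaMeasure n₁ (1 / θ₁)).prod (gammaMeasure n₂ (1 / θ₂)))
      ((acceptRegion n₁ n₂ c₁ c₂).indicator fun z => z.1 ^ a * z.2 ^ b)
      (Real.Gamma (n₁ + a) / (Real.Gamma n₁ * (1 / θ₁) ^ a) *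
        (Real.Gamma (n₂ + b) / (Real.Gamma n₂ * (1 / θ₂) ^ b)) *
        (incBeta (1 - n₂ / (n₂ + c₂ * n₁ * (θ₂ / θ₁))) (n₁ + a) (n₂ + b) -
          incBeta (1 - n₂ / (n₂ + c₁ * n₁ * (θ₂ / θ₁))) (n₁ + a) (n₂ + b))) := by
  have h₁ : (1 : ℝ) ≤ n₁ + a := by exact_mod_cast hn₁.trans (Nat.le_add_right _ _)
  have h₂ : (1 : ℝ) ≤ n₂ + b := by exact_mod_cast hn₂.trans (Nat.le_add_right _ _)
  rw [← measureReal_acceptRegion h₁ h₂ hθ₁ hθ₂ hn₁ hn₂ hc₁ hc]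
  exact hasMean_indicator_pow_mul_pow (by positivity) (by positivity) (by positivity)
    (by positivity) a b (measurableSet_acceptRegion n₁ n₂ c₁ c₂)

lemma hasMean_fst_pow {θ₁ θ₂ : ℝ} (hθ₁ : 0 < θ₁) (hθ₂ : 0 < θ₂) {n₁ n₂ : ℕ}
    (hn₁ : 1 ≤ n₁) (hn₂ : 1 ≤ n₂) (a : ℕ) :
    HasMean ((gammaMeasure n₁ (1 / θ₁)).prod (gammaMeasure n₂ (1 / θ₂))) (fun z => z.1 ^ a)
      (Real.Gamma (n₁ + a) / (Real.Gamma n₁ * (1 / θ₁) ^ a)) := by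
  have hr₁ : 0 < 1 / θ₁ := by positivity
  have hr₂ : 0 < 1 / θ₂ := by positivity
  have h₁ : (0 : ℝ) < n₁ + a := by positivity
  have h₂ : (0 : ℝ) < n₂ := by positivity
  have := isProbabilityMeasure_gammaMeasure h₁ hr₁
  have := isProbabilityMeasure_gammaMeasure h₂ hr₂
  have h := hasMean_indicator_pow_mul_pow (p := n₁) (q := n₂) (by positivity) h₂ hr₁ hr₂ a 0
    MeasurableSet.univ
  simp only [Nat.cast_zero, add_zero] at h
  refine h.congr (fun z => by simp) ?_
  rw [probReal_univ]
  simp [(Real.Gamma_pos_of_pos h₂).ne']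

lemma Gamma_add_one_div {n θ : ℝ} (hn : 0 < n) (hθ : 0 < θ) :
    Real.Gamma (n + 1) / (Real.Gamma n * (1 / θ)) = n * θ := by
  have := Real.Gamma_pos_of_pos hn
  rw [Real.Gamma_add_one hn.ne']
  field_simp

lemma Gamma_add_two_div {n θ : ℝ} (hn : 0 < n) (hθ : 0 < θ) :
    Real.Gamma (n + 2) / (Real.Gamma n * (1 / θ) ^ 2) = n * (n + 1) * θ ^ 2 := by
  have := Real.Gamma_pos_of_pos hn
  rw [show n + 2 = n + 1 + 1 by ring, Real.Gamma_add_one (by positivity), Real.Gamma_add_one hn.ne']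
  field_simp

end RecordPT

theorem lemma1 {Ω : Type*} [MeasurableSpace Ω] (μ : Measure Ω) [IsProbabilityMeasure μ]
    (X Y : ℕ → Ω → ℝ) (θ₁ θ₂ : ℝ) (hθ₁ : 0 < θ₁) (hθ₂ : 0 < θ₂)
    (hX : ∀ i, HasLaw (X i) (expMeasure (1 / θ₁)) μ)
    (hY : ∀ i, HasLaw (Y i) (expMeasure (1 / θ₂)) μ)
    (hXi : iIndepFun X μ) (hYi : iIndepFun Y μ)
    (hXY : IndepFun (fun ω i => X i ω) (fun ω i => Y i ω) μ)
    (n₁ n₂ : ℕ) (hn₁ : 1 ≤ n₁) (hn₂ : 1 ≤ n₂)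
    (c₁ c₂ : ℝ) (hc₁ : 0 ≤ c₁) (hc : c₁ ≤ c₂)
    (T : Ω → ℝ)
    (hT : T = fun ω => RecordPT.prelimTestEst n₁ n₂ c₁ c₂ (fun i => X i ω) (fun i => Y i ω))
    (lam δ d₁ d₂ : ℝ) (hlam : lam = (n₂ : ℝ) / (n₁ + n₂)) (hδ : δ = θ₂ / θ₁)
    (hd₁ : d₁ = 1 - n₂ / (n₂ + c₁ * n₁ * δ)) (hd₂ : d₂ = 1 - n₂ / (n₂ + c₂ * n₁ * δ)) :
    MemLp T 2 μ ∧
    RecordPT.bias μ T θ₁ =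
      - lam * (θ₁ * (RecordPT.incBeta d₂ (n₁ + 1) n₂ - RecordPT.incBeta d₁ (n₁ + 1) n₂))
      + lam * (θ₂ * (RecordPT.incBeta d₂ n₁ (n₂ + 1) - RecordPT.incBeta d₁ n₁ (n₂ + 1))) ∧
    RecordPT.mse μ T θ₁ =
      (n₁ + 1) / n₁ * θ₁ ^ 2
      + (lam ^ 2 - 2 * lam) * θ₁ ^ 2 * ((n₁ + 1) / n₁)
          * (RecordPT.incBeta d₂ (n₁ + 2) n₂ - RecordPT.incBeta d₁ (n₁ + 2) n₂)
      + lam ^ 2 * θ₂ ^ 2 * ((n₂ + 1) / n₂)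
          * (RecordPT.incBeta d₂ n₁ (n₂ + 2) - RecordPT.incBeta d₁ n₁ (n₂ + 2))
      + 2 * (lam - lam ^ 2) * θ₁ * θ₂
          * (RecordPT.incBeta d₂ (n₁ + 1) (n₂ + 1) - RecordPT.incBeta d₁ (n₁ + 1) (n₂ + 1))
      - 2 * θ₁ ^ 2
      - 2 * lam * θ₁ * θ₂
          * (RecordPT.incBeta d₂ n₁ (n₂ + 1) - RecordPT.incBeta d₁ n₁ (n₂ + 1))
      + 2 * lam * θ₁ ^ 2
          * (RecordPT.incBeta d₂ (n₁ + 1) n₂ - RecordPT.incBeta d₁ (n₁ + 1) n₂)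
      + θ₁ ^ 2 := by
  have hr₁ : 0 < 1 / θ₁ := by positivity
  have hr₂ : 0 < 1 / θ₂ := by positivity
  have hN₁ : (0 : ℝ) < n₁ := by positivity
  have hN₂ : (0 : ℝ) < n₂ := by positivity
  have := isProbabilityMeasure_gammaMeasure hN₁ hr₁
  have := isProbabilityMeasure_gammaMeasure hN₂ hr₂
  have hlaw := RecordPT.hasLaw_prodMk_upperRecord hr₁ hr₂ hX hY hXi hYi hXY hn₁ hn₂
  simp_rw [RecordPT.prelimTestEst_eq hn₁ hn₂] at hT
  set W : Ω → ℝ × ℝ := fun ω => (RecordPT.upperRecord (fun i => X i ω) n₁,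
    RecordPT.upperRecord (fun i => Y i ω) n₂)
  set π := (gammaMeasure n₁ (1 / θ₁)).prod (gammaMeasure n₂ (1 / θ₂))
  have hm (a b : ℕ) := RecordPT.hasMean_acceptRegion_pow_mul_pow hθ₁ hθ₂ hn₁ hn₂ hc₁ hc a b
  simp_rw [← hδ, ← hd₁, ← hd₂] at hm
  have m10 := hm 1 0
  have m01 := hm 0 1
  have m11 := hm 1 1
  have m20 := hm 2 0
  have m02 := hm 0 2
  have m1 := RecordPT.hasMean_fst_pow hθ₁ hθ₂ hn₁ hn₂ 1
  have m2 := RecordPT.hasMean_fst_pow hθ₁ hθ₂ hn₁ hn₂ 2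
  have hΓ₁ := (Real.Gamma_pos_of_pos hN₁).ne'
  have hΓ₂ := (Real.Gamma_pos_of_pos hN₂).ne'
  simp only [Nat.cast_one, Nat.cast_zero, Nat.cast_ofNat, add_zero, pow_zero, pow_one, mul_one,
    one_mul, div_self hΓ₁, div_self hΓ₂, RecordPT.Gamma_add_one_div hN₁ hθ₁,
    RecordPT.Gamma_add_one_div hN₂ hθ₂, RecordPT.Gamma_add_two_div hN₁ hθ₁,
    RecordPT.Gamma_add_two_div hN₂ hθ₂] at m10 m01 m11 m20 m02 m1 m2
  have hbias : RecordPT.HasMean π (RecordPT.prelimTestFun n₁ n₂ c₁ c₂)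
      (θ₁ + (- lam * (θ₁ * (RecordPT.incBeta d₂ (n₁ + 1) n₂ - RecordPT.incBeta d₁ (n₁ + 1) n₂))
      + lam * (θ₂ * (RecordPT.incBeta d₂ n₁ (n₂ + 1) - RecordPT.incBeta d₁ n₁ (n₂ + 1))))) := by
    refine ((m1.const_mul (1 / n₁)).add
      ((m01.const_mul (lam / n₂)).add (m10.const_mul (-lam / n₁)))).congr (fun z => ?_) ?_
    · rw [RecordPT.prelimTestFun, ← hlam]
      by_cases h : z ∈ RecordPT.acceptRegion n₁ n₂ c₁ c₂ <;>
        simp only [h, not_false_eq_true, Set.indicator_of_mem, Set.indicator_of_notMem] <;> ring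
    · field_simp
      ring
  -- Expansion of `(U / n₁ - θ + λ 1_A (V / n₂ - U / n₁)) ^ 2` with `1_A ^ 2 = 1_A`. On `A`, the
  -- cross term and the squared correction together give `U ^ 2` the coefficient `λ ^ 2 - 2 λ` and
  -- `U V` the coefficient `2 (λ - λ ^ 2)`, up to powers of `n₁`, `n₂`. The centre `θ` is left free
  -- so that two values can be used.
  have hsq (θ : ℝ) := ((m2.const_mul (1 / n₁ ^ 2)).add ((m1.const_mul (-2 * θ / n₁)).add
    ((m20.const_mul ((lam ^ 2 - 2 * lam) / n₁ ^ 2)).add ((m02.const_mul (lam ^ 2 / n₂ ^ 2)).add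
    ((m11.const_mul (2 * (lam - lam ^ 2) / (n₁ * n₂))).add
    ((m01.const_mul (-2 * θ * lam / n₂)).add ((m10.const_mul (2 * θ * lam / n₁)).add
    (RecordPT.HasMean.const (θ ^ 2))))))))).congr
    (g := fun z => (RecordPT.prelimTestFun n₁ n₂ c₁ c₂ z - θ) ^ 2) (fun z => by
      rw [RecordPT.prelimTestFun, ← hlam]
      by_cases h : z ∈ RecordPT.acceptRegion n₁ n₂ c₁ c₂ <;>
        simp only [h, not_false_eq_true, Set.indicator_of_mem, Set.indicator_of_notMem] <;>
        field_simp <;> ring) rfl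
  have hbias' := hbias.comp_hasLaw hlaw
  have hsq' (θ : ℝ) := (hsq θ).comp_hasLaw hlaw
  subst hT
  refine ⟨?_, ?_, ?_⟩
  · rw [memLp_two_iff_integrable_sq hbias'.1.aestronglyMeasurable]
    -- Centre `0` gives square integrability; centre `θ₁` gives the mean square error.
    simpa using (hsq' 0).1
  · rw [RecordPT.bias, hbias'.2]
    ring
  · rw [RecordPT.mse, (hsq' θ₁).2]
    field_simp
    ring
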